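/- Let $(M,g)$ be a compact smooth $n$-dimensional Riemannian manifold without boundary, with geodesic distance $d$ (equal to $\infty$ between points of different components), Riemannian volume measure $dV$ and closed balls $B(x,r)=\{z : d(x,z)\le r\}$. Let $\rho\colon M\to(0,\infty)$ be a continuous probability density function with respect to $dV$. Let $X=\{x_1,\dots,x_N\}$, $N\ge 2$, be a random cloud of $N$ points drawn from $\rho$. Consider one of its points, $x=x_i$, and regard it as fixed (an arbitrary point of $M$), so that the other $N-1$ points are independent with density $\rho$; expectations, variances and mean squared errors are taken over these $N-1$ points. For $r>0$ let $N(x,r)$ be the number of indices $j\ne i$ with $d(x,x_j)\le r$, let $$\hat\rho_{\mathrm{avg}}(x,r)=\begin{cases}\Big(\frac1{N(x,r)}\sum_{j\ne i,\ d(x,x_j)\le r}\frac1{\rho(x_j)}\Big)^{-1}, & N(x,r)>0,\\ \rho(x), & N(x,r)=0,\end{cases}$$ and define the true and the estimated ball-volume ratios by $$y(x,r)=\frac{\mathrm{vol}(B(x,r))}{v_n r^n},\qquad \hat y(x,r)=\frac{1}{v_n r^n}\cdot\frac{N(x,r)}{(N-1)\,\hat\rho_{\mathrm{avg}}(x,r)},$$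 where $v_n$ is the volume of the unit ball of $\mathbb R^n$. Then the following hold. 1. For all $N\ge 2$, $r>0$, $i$ and $x$, the random variable $\hat y(x,r)$ is square integrable, $\mathbb E[\hat y(x,r)]=y(x,r)$, and therefore $$\mathrm{MSE}(\hat y(x,r)):=\mathbb E\big[(\hat y(x,r)-y(x,r))^2\big]=\mathrm{var}(\hat y(x,r)).$$ 2. There are constants $A>0$, $N_0$ and $r_0>0$, depending only on $\rho$ and on $(M,g)$, such that $$\mathrm{var}(\hat y(x,r))\le\frac{A}{N r^n}\qquad\text{for all } N\ge N_0,\ 0<r<r_0,\text{ all } i \text{ and all } x.$$ -/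

import Mathlib

open MeasureTheory ProbabilityTheory Manifold Bundle
open scoped ENNReal ContDiff Topology

noncomputable section

/-! ### The Riemannian volume measure -/

section Volume

theorem exists_seq_chart_cover (n : ℕ) {M : Type*} [TopologicalSpace M]
    [ChartedSpace (EuclideanSpace ℝ (Fin n)) M] [SecondCountableTopology M] [Nonempty M] :
    ∃ p : ℕ → M, ⋃ k, (extChartAt (𝓡 n) (p k)).source = Set.univ := by
  obtain ⟨t, ht, htU⟩ := TopologicalSpace.countable_cover_nhds
    (fun x : M ↦ extChartAt_source_mem_nhds (I := 𝓡 n) x)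
  have hne : t.Nonempty := by
    by_contra h
    rw [Set.not_nonempty_iff_eq_empty] at h
    exact Set.empty_ne_univ (by simpa [h] using htU)
  obtain ⟨p, rfl⟩ := ht.exists_eq_range hne
  exact ⟨p, by simpa using htU⟩

variable (n : ℕ) {M : Type*} [TopologicalSpace M]
  [ChartedSpace (EuclideanSpace ℝ (Fin n)) M]
  [RiemannianBundle (fun x : M ↦ TangentSpace (𝓡 n) x)]

/-- The coordinate vector field `∂ᵢ` of the chart `φ` around `p`, at the point `φ⁻¹ y`. -/
def coordVector (p : M) (y : EuclideanSpace ℝ (Fin n)) (i : Fin n) :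
    TangentSpace (𝓡 n) ((extChartAt (𝓡 n) p).symm y) :=
  mfderiv 𝓘(ℝ, EuclideanSpace ℝ (Fin n)) (𝓡 n) (extChartAt (𝓡 n) p).symm y
    (EuclideanSpace.single i (1 : ℝ))

/-- The matrix `(g_ij)` of the Riemannian metric in the chart around `p`. -/
def gramMatrix (p : M) (y : EuclideanSpace ℝ (Fin n)) : Matrix (Fin n) (Fin n) ℝ :=
  Matrix.of fun i j ↦ inner ℝ (coordVector n p y i) (coordVector n p y j)

/-- The measure `√|g| dx¹ ⋯ dxⁿ` carried by the domain of the chart around `p`, as a measure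
on `M`. -/
def chartVolume [MeasurableSpace M] (p : M) : Measure M :=
  ((volume.restrict (extChartAt (𝓡 n) p).target).withDensity
    fun y ↦ ENNReal.ofReal (√ (gramMatrix n p y).det)).map (extChartAt (𝓡 n) p).symm

open Classical in
/-- The Riemannian volume measure: it agrees with `√|g| dx¹ ⋯ dxⁿ` on the domain of every chart.
It is obtained by covering the manifold by a sequence of chart domains, cutting these into
disjoint Borel pieces, and using the local formula on each piece. By the change of variables
formula the result does not depend on the cover. Such a cover exists on every nonempty
second countable manifold (see `exists_seq_chart_cover`). -/
def riemannianVolume (M : Type*) [TopologicalSpace M]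
    [ChartedSpace (EuclideanSpace ℝ (Fin n)) M]
    [RiemannianBundle (fun x : M ↦ TangentSpace (𝓡 n) x)] [MeasurableSpace M] : Measure M :=
  if h : ∃ p : ℕ → M, ⋃ k, (extChartAt (𝓡 n) (p k)).source = Set.univ then
    Measure.sum fun k ↦ (chartVolume n (h.choose k)).restrict
      (disjointed (fun k ↦ (extChartAt (𝓡 n) (h.choose k)).source) k)
  else 0

end Volume

/-! ### The estimators, computed from a distance matrix -/

section Estimators

/-- The volume of the unit ball in `ℝⁿ`. -/
def unitBallVolume (n : ℕ) : ℝ :=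
  volume.real (Metric.closedBall (0 : EuclideanSpace ℝ (Fin n)) 1)

variable {N : ℕ}

open Classical in
/-- The indices of the points of the cloud, other than the `i`-th one, within distance `r` of the
`i`-th one. Distances may be `∞`, namely between different connected components. -/
def neighbors (dX : Matrix (Fin N) (Fin N) ℝ≥0∞) (i : Fin N) (r : ℝ) : Finset (Fin N) :=
  {j | j ≠ i ∧ dX i j ≤ ENNReal.ofReal r}

/-- The number of points of the cloud, other than the `i`-th one, within distance `r` of it. -/
def numNeighbors (dX : Matrix (Fin N) (Fin N) ℝ≥0∞) (i : Fin N) (r : ℝ) : ℕ :=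
  (neighbors dX i r).card

/-- The estimate of the mean density in the ball: the harmonic mean of the (estimated) densities
`ρhat j` at the points of the cloud that lie in the ball. -/
def meanDensityEst (dX : Matrix (Fin N) (Fin N) ℝ≥0∞) (ρhat : Fin N → ℝ) (i : Fin N) (r : ℝ) : ℝ :=
  if 0 < numNeighbors dX i r then
    (1 / (numNeighbors dX i r : ℝ) * ∑ j ∈ neighbors dX i r, 1 / ρhat j)⁻¹
  else ρhat i

/-- The estimate of the volume of the ball of radius `r` centered at the `i`-th point. -/
def ballVolumeEst (dX : Matrix (Fin N) (Fin N) ℝ≥0∞) (ρhat : Fin N → ℝ) (i : Fin N) (r : ℝ) : ℝ :=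
  (numNeighbors dX i r : ℝ) / (((N : ℝ) - 1) * meanDensityEst dX ρhat i r)

/-- The estimated ball-volume ratio `ŷ[d_X, ρhat, nhat](x_i, r)`. -/
def ballRatioEst (dX : Matrix (Fin N) (Fin N) ℝ≥0∞) (ρhat : Fin N → ℝ) (nhat : ℕ) (i : Fin N)
    (r : ℝ) : ℝ :=
  ballVolumeEst dX ρhat i r / (unitBallVolume nhat * r ^ nhat)

end Estimators

/-- The matrix of distances between the points of a cloud. -/
def distMatrix {M : Type*} [EMetricSpace M] {N : ℕ} (X : Fin N → M) :
    Matrix (Fin N) (Fin N) ℝ≥0∞ :=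
  Matrix.of fun j k ↦ edist (X j) (X k)

section Sampling

variable (n : ℕ) {M : Type*} [EMetricSpace M] [ChartedSpace (EuclideanSpace ℝ (Fin n)) M]
  [RiemannianBundle (fun x : M ↦ TangentSpace (𝓡 n) x)] [MeasurableSpace M]

/-- The true ball-volume ratio `y(x, r) = vol B(x, r) / (v_n rⁿ)`, for closed balls. -/
def ballRatio (x : M) (r : ℝ) : ℝ :=
  (riemannianVolume n M).real (Metric.closedEBall x (ENNReal.ofReal r)) / (unitBallVolume n * r ^ n)

/-- The measure `ρ dV` on `M`. -/
def densityMeasure (ρ : M → ℝ) : Measure M :=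
  (riemannianVolume n M).withDensity fun x ↦ ENNReal.ofReal (ρ x)

/-- `ρ` is a (continuous, positive) probability density function with respect to the
Riemannian volume. -/
structure IsPdf (ρ : M → ℝ) : Prop where
  continuous : Continuous ρ
  pos : ∀ x, 0 < ρ x
  lintegral_eq_one : ∫⁻ x, ENNReal.ofReal (ρ x) ∂(riemannianVolume n M) = 1

/-- `X` is a random cloud of `N` points whose `i`-th point is the fixed point `x` and whose other
`N - 1` points are drawn independently from the density `ρ`. -/
structure IsSampleAt (ρ : M → ℝ) {N : ℕ} (i : Fin N) (x : M) {Ω : Type*} [MeasurableSpace Ω]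
    (P : Measure Ω) (X : Fin N → Ω → M) : Prop where
  center : ∀ w, X i w = x
  law : ∀ j, j ≠ i → HasLaw (X j) (densityMeasure n ρ) P
  indep : iIndepFun X P

/-- The random variable `ŷ(x_i, r)`, for the exact distances, the exact density and the exact
dimension. -/
def sampleBallRatio (ρ : M → ℝ) {N : ℕ} {Ω : Type*} (X : Fin N → Ω → M) (i : Fin N) (r : ℝ)
    (w : Ω) : ℝ :=
  ballRatioEst (distMatrix fun j ↦ X j w) (fun j ↦ ρ (X j w)) n i r

end Sampling

/-- The mean squared error of the estimator `Y` of the number `θ`. -/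
def meanSquaredError {Ω : Type*} [MeasurableSpace Ω] (P : Measure Ω) (Y : Ω → ℝ) (θ : ℝ) : ℝ :=
  ∫ w, (Y w - θ) ^ 2 ∂P

end

/-! The harmonic mean is built so that `N(x,r) / ρ_avg` is the sum of `1/ρ(x_j)` over the
neighbours. Hence `ŷ` is a multiple of a sum of `N - 1` independent copies of the weight `1_B / ρ`,
as in importance sampling: under `ρ dV` the weight has mean `vol B`, so `ŷ` is unbiased
(`IsPdf.integral_ballWeight`).

By compactness `1/ρ ≤ b`, so the weight is at most `b` and its variance at most `b · vol B`.
Independence then gives `var ŷ ≤ b · vol B / ((N - 1) (v_n rⁿ)²)`, and what remains is geometric: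
`vol B(x,r) ≤ K rⁿ` uniformly in `x`. Near a point `p` the chart is Lipschitz and `√|g|` is bounded,
so a small ball has at most the volume of a Euclidean ball of comparable radius, up to a constant;
compactness makes the constants uniform. Since the volume is defined through a chosen cover, the
change of variables formula is needed first, to compute it in the chart around `p`. -/

/-! ### Changes of charts and their derivatives. -/

section Charts

variable {n : ℕ} {M : Type*} [TopologicalSpace M]
  [ChartedSpace (EuclideanSpace ℝ (Fin n)) M]

/-- The derivative of the inverse of the chart around `p`, as an endomorphism of the model
space. -/
noncomputable def chartSymmDeriv (n : ℕ) {M : Type*} [TopologicalSpace M]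
    [ChartedSpace (EuclideanSpace ℝ (Fin n)) M] (p : M) (y : EuclideanSpace ℝ (Fin n)) :
    EuclideanSpace ℝ (Fin n) →L[ℝ] EuclideanSpace ℝ (Fin n) :=
  mfderiv 𝓘(ℝ, EuclideanSpace ℝ (Fin n)) (𝓡 n) (extChartAt (𝓡 n) p).symm y

/-- The change of charts, from the chart around `q` to the chart around `p`. -/
noncomputable def chartChange (q p : M) : EuclideanSpace ℝ (Fin n) → EuclideanSpace ℝ (Fin n) :=
  extChartAt (𝓡 n) p ∘ (extChartAt (𝓡 n) q).symm

theorem apply_single_eq_sum (A : EuclideanSpace ℝ (Fin n) →L[ℝ] EuclideanSpace ℝ (Fin n))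
    (v : EuclideanSpace ℝ (Fin n)) : A v = ∑ k, v k • A (EuclideanSpace.single k 1) := by
  have h : v = ∑ k, v k • EuclideanSpace.single k (1 : ℝ) := by
    ext j
    simp [Finset.sum_apply, Pi.single_apply]
  conv_lhs => rw [h]
  simp only [map_sum, map_smul]

variable [IsManifold (𝓡 n) ∞ M]

theorem differentiableAt_chartChange {q p : M} {y : EuclideanSpace ℝ (Fin n)}
    (hy : y ∈ (extChartAt (𝓡 n) q).target)
    (hy' : (extChartAt (𝓡 n) q).symm y ∈ (extChartAt (𝓡 n) p).source) :
    DifferentiableAt ℝ (chartChange (n := n) q p) y := by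
  have h := (contDiffWithinAt_ext_coord_change (I := 𝓡 n) (n := ∞) p q (y := y)
    (by rw [PartialEquiv.trans_source]; exact ⟨hy, hy'⟩))
  simp only [modelWithCornersSelf_coe, Set.range_id, contDiffWithinAt_univ] at h
  exact h.differentiableAt (by simp)

theorem chartSymmDeriv_chartChange {q p : M} {y : EuclideanSpace ℝ (Fin n)}
    (hy : y ∈ (extChartAt (𝓡 n) q).target)
    (hy' : (extChartAt (𝓡 n) q).symm y ∈ (extChartAt (𝓡 n) p).source) :
    chartSymmDeriv n q y = (chartSymmDeriv n p (chartChange (n := n) q p y)).comp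
      (fderiv ℝ (chartChange (n := n) q p) y) := by
  have hF := differentiableAt_chartChange hy hy'
  have htgt : chartChange (n := n) q p y ∈ (extChartAt (𝓡 n) p).target :=
    (extChartAt (𝓡 n) p).map_source hy'
  have hev : (extChartAt (𝓡 n) q).symm =ᶠ[𝓝 y]
      (extChartAt (𝓡 n) p).symm ∘ chartChange (n := n) q p := by
    have hc : ContinuousAt (extChartAt (𝓡 n) q).symm y := continuousAt_extChartAt_symm'' hy
    filter_upwards [hc.preimage_mem_nhds ((isOpen_extChartAt_source p).mem_nhds hy')] with z hz
    exact ((extChartAt (𝓡 n) p).left_inv hz).symm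
  have hd : MDifferentiableAt 𝓘(ℝ, EuclideanSpace ℝ (Fin n)) (𝓡 n) (extChartAt (𝓡 n) p).symm
      (chartChange (n := n) q p y) := by
    have := mdifferentiableWithinAt_extChartAt_symm (I := 𝓡 n) htgt
    simpa [mdifferentiableWithinAt_univ] using this
  have h := (hev.mfderiv_eq (I := 𝓘(ℝ, EuclideanSpace ℝ (Fin n))) (I' := 𝓡 n)).trans
    (mfderiv_comp y hd hF.mdifferentiableAt)
  rw [mfderiv_eq_fderiv] at h
  exact h

end Charts

/-! ### Transformation of the Gram determinant. -/

section Volume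

variable {n : ℕ} {M : Type*} [TopologicalSpace M]
  [ChartedSpace (EuclideanSpace ℝ (Fin n)) M]
  [RiemannianBundle (fun x : M ↦ TangentSpace (𝓡 n) x)]

/-- The metric at `x`, applied to vectors of the model space. -/
noncomputable def metricAt (n : ℕ) {M : Type*} [TopologicalSpace M]
    [ChartedSpace (EuclideanSpace ℝ (Fin n)) M]
    [RiemannianBundle (fun x : M ↦ TangentSpace (𝓡 n) x)] (x : M)
    (v w : EuclideanSpace ℝ (Fin n)) : ℝ :=
  @inner ℝ (TangentSpace (𝓡 n) x) _ v w

theorem gramMatrix_apply (p : M) (y : EuclideanSpace ℝ (Fin n)) (i j : Fin n) :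
    gramMatrix n p y i j = metricAt n ((extChartAt (𝓡 n) p).symm y)
      (chartSymmDeriv n p y (EuclideanSpace.single i 1))
      (chartSymmDeriv n p y (EuclideanSpace.single j 1)) := rfl

/-- Bilinearity. The space is given explicitly throughout, since the vectors are typed in the model
space, which has its own Euclidean inner product. -/
theorem metricAt_sum_sum {ι : Type*} [Fintype ι] (x : M) (a b : ι → ℝ)
    (v : ι → EuclideanSpace ℝ (Fin n)) :
    metricAt n x (∑ k, a k • v k) (∑ l, b l • v l) =
      ∑ k, ∑ l, a k * b l * metricAt n x (v k) (v l) := by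
  have h := sum_inner (𝕜 := ℝ) (E := TangentSpace (𝓡 n) x) Finset.univ (fun k ↦ a k • v k)
    (∑ l, b l • v l)
  refine h.trans (Finset.sum_congr rfl fun k _ ↦ ?_)
  have h' := inner_sum (𝕜 := ℝ) (E := TangentSpace (𝓡 n) x) Finset.univ (fun l ↦ b l • v l)
    (a k • v k)
  refine h'.trans (Finset.sum_congr rfl fun l _ ↦ ?_)
  have h₁ := real_inner_smul_left (F := TangentSpace (𝓡 n) x) (v k) (b l • v l) (a k)
  have h₂ := real_inner_smul_right (F := TangentSpace (𝓡 n) x) (v k) (v l) (b l)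
  refine h₁.trans ?_
  rw [mul_assoc]
  exact congrArg _ h₂

/-- With `J` the Jacobian matrix of the change of charts, `G_q = Jᵀ G_p J`. -/
theorem sqrt_det_gramMatrix_chartChange [IsManifold (𝓡 n) ∞ M] {q p : M}
    {y : EuclideanSpace ℝ (Fin n)}
    (hy : y ∈ (extChartAt (𝓡 n) q).target)
    (hy' : (extChartAt (𝓡 n) q).symm y ∈ (extChartAt (𝓡 n) p).source) :
    √(gramMatrix n q y).det = |(fderiv ℝ (chartChange (n := n) q p) y).det| *
      √(gramMatrix n p (chartChange (n := n) q p y)).det := by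
  set J : Matrix (Fin n) (Fin n) ℝ := LinearMap.toMatrix
    (EuclideanSpace.basisFun (Fin n) ℝ).toBasis (EuclideanSpace.basisFun (Fin n) ℝ).toBasis
    (fderiv ℝ (chartChange (n := n) q p) y).toLinearMap with hJ
  have hJa (k i) : J k i =
      (fderiv ℝ (chartChange (n := n) q p) y (EuclideanSpace.single i 1)) k := by
    simp [hJ, LinearMap.toMatrix_apply]
  have hdet : J.det = (fderiv ℝ (chartChange (n := n) q p) y).det := by
    rw [hJ, LinearMap.det_toMatrix]
  have hx : (extChartAt (𝓡 n) p).symm (chartChange (n := n) q p y) =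
      (extChartAt (𝓡 n) q).symm y := (extChartAt (𝓡 n) p).left_inv hy'
  have hG : gramMatrix n q y = J.transpose * gramMatrix n p (chartChange (n := n) q p y) * J := by
    ext i j
    rw [gramMatrix_apply, chartSymmDeriv_chartChange hy hy', ContinuousLinearMap.comp_apply,
      ContinuousLinearMap.comp_apply, apply_single_eq_sum _ (fderiv ℝ _ y _),
      apply_single_eq_sum _ (fderiv ℝ _ y (EuclideanSpace.single j 1)), metricAt_sum_sum]
    simp only [Matrix.mul_apply, Matrix.transpose_apply, Finset.sum_mul, hJa, gramMatrix_apply, hx]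
    rw [Finset.sum_comm]
    refine Finset.sum_congr rfl fun k _ ↦ Finset.sum_congr rfl fun l _ ↦ ?_
    ring
  rw [hG, Matrix.det_mul, Matrix.det_mul, Matrix.det_transpose, hdet, mul_right_comm,
    ← pow_two, Real.sqrt_mul (sq_nonneg _), Real.sqrt_sq_eq_abs]

end Volume

/-! ### Independence of the volume from the chart. -/

section ChartVolume

variable {n : ℕ} {M : Type*} [TopologicalSpace M]
  [ChartedSpace (EuclideanSpace ℝ (Fin n)) M]

theorem measurableSet_target_inter_symm_preimage [MeasurableSpace M] [BorelSpace M] (p : M)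
    {s : Set M} (hs : MeasurableSet s) :
    MeasurableSet ((extChartAt (𝓡 n) p).target ∩ (extChartAt (𝓡 n) p).symm ⁻¹' s) := by
  have h : Measurable ((extChartAt (𝓡 n) p).target.domRestrict (extChartAt (𝓡 n) p).symm) :=
    (continuousOn_extChartAt_symm p).domRestrict.measurable
  convert! (isOpen_extChartAt_target (I := 𝓡 n) p).measurableSet.subtype_image (h hs) using 1
  ext y
  exact ⟨fun ⟨hy, hys⟩ ↦ ⟨⟨y, hy⟩, hys, rfl⟩, fun ⟨⟨_, hy⟩, hys, h⟩ ↦ h ▸ ⟨hy, hys⟩⟩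

variable [RiemannianBundle (fun x : M ↦ TangentSpace (𝓡 n) x)]
  [MeasurableSpace M] [BorelSpace M]

theorem chartVolume_apply (p : M) {s : Set M} (hs : MeasurableSet s) :
    chartVolume n p s =
      ∫⁻ y in (extChartAt (𝓡 n) p).target ∩ (extChartAt (𝓡 n) p).symm ⁻¹' s,
        ENNReal.ofReal (√(gramMatrix n p y).det) := by
  have hT := (isOpen_extChartAt_target (I := 𝓡 n) p).measurableSet
  have hm : AEMeasurable (extChartAt (𝓡 n) p).symm
      ((volume.restrict (extChartAt (𝓡 n) p).target).withDensity
        fun y ↦ ENNReal.ofReal (√ (gramMatrix n p y).det)) :=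
    ((continuousOn_extChartAt_symm p).aemeasurable hT).mono_ac
      (withDensity_absolutelyContinuous _ _)
  rw [chartVolume, Measure.map_apply_of_aemeasurable hm hs, withDensity_apply',
    Measure.restrict_restrict' hT, Set.inter_comm]

variable [IsManifold (𝓡 n) ∞ M]

/-- The Jacobian in the change of variables formula is exactly the factor relating the two densities
`√|g|`. -/
theorem chartVolume_eq_of_subset_source (p q : M) {s : Set M} (hs : MeasurableSet s)
    (hp : s ⊆ (extChartAt (𝓡 n) p).source) (hq : s ⊆ (extChartAt (𝓡 n) q).source) :
    chartVolume n q s = chartVolume n p s := by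
  rw [chartVolume_apply q hs, chartVolume_apply p hs]
  set A := (extChartAt (𝓡 n) q).target ∩ (extChartAt (𝓡 n) q).symm ⁻¹' s with hA
  have himg : (extChartAt (𝓡 n) p).target ∩ (extChartAt (𝓡 n) p).symm ⁻¹' s =
      chartChange q p '' A := by
    ext y
    constructor
    · rintro ⟨hy, hys⟩
      refine ⟨extChartAt (𝓡 n) q ((extChartAt (𝓡 n) p).symm y),
        ⟨(extChartAt (𝓡 n) q).map_source (hq hys), ?_⟩, ?_⟩
      · rw [Set.mem_preimage, (extChartAt (𝓡 n) q).left_inv (hq hys)]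
        exact hys
      · rw [chartChange, Function.comp_apply, (extChartAt (𝓡 n) q).left_inv (hq hys),
          (extChartAt (𝓡 n) p).right_inv hy]
    · rintro ⟨z, ⟨hz, hzs⟩, rfl⟩
      refine ⟨(extChartAt (𝓡 n) p).map_source (hp hzs), ?_⟩
      rw [Set.mem_preimage, chartChange, Function.comp_apply,
        (extChartAt (𝓡 n) p).left_inv (hp hzs)]
      exact hzs
  have hinj : Set.InjOn (chartChange (n := n) q p) A := by
    rintro z ⟨hz, hzs⟩ z' ⟨hz', hzs'⟩ h
    exact (extChartAt (𝓡 n) q).symm.injOn hz hz'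
      ((extChartAt (𝓡 n) p).injOn (hp hzs) (hp hzs') h)
  have hAm : MeasurableSet A := measurableSet_target_inter_symm_preimage q hs
  rw [himg, lintegral_image_eq_lintegral_abs_det_fderiv_mul volume hAm
    (fun z hz ↦ (differentiableAt_chartChange hz.1 (hp hz.2)).hasFDerivAt.hasFDerivWithinAt) hinj]
  refine setLIntegral_congr_fun hAm fun z hz ↦ ?_
  rw [sqrt_det_gramMatrix_chartChange hz.1 (hp hz.2), ENNReal.ofReal_mul (abs_nonneg _)]

/-- Each disjoint piece of `s` can be measured in the chart around `p` instead of its own; countable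
additivity reassembles `s`. -/
theorem riemannianVolume_apply_of_subset_source [SecondCountableTopology M] (p : M) {s : Set M}
    (hs : MeasurableSet s) (hp : s ⊆ (extChartAt (𝓡 n) p).source) :
    riemannianVolume n M s = chartVolume n p s := by
  have : Nonempty M := ⟨p⟩
  have h := exists_seq_chart_cover n (M := M)
  rw [riemannianVolume, dif_pos h, Measure.sum_apply _ hs]
  set U := fun k ↦ (extChartAt (𝓡 n) (h.choose k)).source with hU
  have hUm (k) : MeasurableSet (disjointed U k) :=
    MeasurableSet.disjointed (fun k ↦ (isOpen_extChartAt_source _).measurableSet) k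
  have hcov : ⋃ k, disjointed U k = Set.univ := iUnion_disjointed.trans h.choose_spec
  calc ∑' k, ((chartVolume n (h.choose k)).restrict (disjointed U k)) s
      = ∑' k, chartVolume n p (s ∩ disjointed U k) := by
        refine tsum_congr fun k ↦ ?_
        rw [Measure.restrict_apply hs]
        exact chartVolume_eq_of_subset_source p _ (hs.inter (hUm k))
          (Set.inter_subset_left.trans hp)
          (Set.inter_subset_right.trans (disjointed_subset U k))
    _ = chartVolume n p (⋃ k, s ∩ disjointed U k) :=
        (measure_iUnion (fun i j hij ↦ ((disjoint_disjointed U) hij).mono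
          Set.inter_subset_right Set.inter_subset_right) fun k ↦ hs.inter (hUm k)).symm
    _ = chartVolume n p s := by rw [← Set.inter_iUnion, hcov, Set.inter_univ]

end ChartVolume

/-! ### Local bounds on the metric and on the distortion of charts. -/

section ChartBounds

open scoped NNReal

variable {n : ℕ} {M : Type*} [EMetricSpace M]
  [ChartedSpace (EuclideanSpace ℝ (Fin n)) M] [IsManifold (𝓡 n) ∞ M]
  [RiemannianBundle (fun x : M ↦ TangentSpace (𝓡 n) x)]
  [IsContMDiffRiemannianBundle (𝓡 n) ∞ (EuclideanSpace ℝ (Fin n))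
    (fun x : M ↦ TangentSpace (𝓡 n) x)]

variable (n M) in
theorem isContinuousRiemannianBundle_tangentSpace :
    IsContinuousRiemannianBundle (EuclideanSpace ℝ (Fin n))
      (fun x : M ↦ TangentSpace (𝓡 n) x) := by
  obtain ⟨g, hg, h⟩ := IsContMDiffRiemannianBundle.exists_contMDiff (IB := 𝓡 n) (n := ∞)
    (F := EuclideanSpace ℝ (Fin n)) (E := fun x : M ↦ TangentSpace (𝓡 n) x)
  exact ⟨g, hg.continuous, h⟩

theorem eventually_enorm_mfderiv_extChartAt_apply_le (p : M) :
    ∃ C : ℝ≥0, ∀ᶠ y in 𝓝 p, ∀ v : TangentSpace (𝓡 n) y,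
      @enorm (EuclideanSpace ℝ (Fin n)) _
        (mfderiv (𝓡 n) 𝓘(ℝ, EuclideanSpace ℝ (Fin n)) (extChartAt (𝓡 n) p) y v) ≤
          C * ‖v‖ₑ := by
  have := isContinuousRiemannianBundle_tangentSpace n M
  have : IsManifold (𝓡 n) 1 M := .of_le (n := ∞) (by simp)
  obtain ⟨C, hC, h⟩ := eventually_enorm_mfderiv_extChartAt_lt (𝓡 n) p
  refine ⟨C, h.mono fun y hy v ↦ ?_⟩
  refine le_trans ?_ (mul_le_mul_left hy.le _)
  exact ContinuousLinearMap.le_opENorm (E := TangentSpace (𝓡 n) y)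
    (F := EuclideanSpace ℝ (Fin n))
    (mfderiv (𝓡 n) 𝓘(ℝ, EuclideanSpace ℝ (Fin n)) (extChartAt (𝓡 n) p) y) v

theorem eventually_metricAt_chartSymmDeriv_le (p : M) :
    ∃ C : ℝ, ∀ᶠ y in 𝓝 (extChartAt (𝓡 n) p p), ∀ v w : EuclideanSpace ℝ (Fin n),
      |metricAt n ((extChartAt (𝓡 n) p).symm y) (chartSymmDeriv n p y v)
        (chartSymmDeriv n p y w)| ≤ (C * ‖v‖) * (C * ‖w‖) := by
  have := isContinuousRiemannianBundle_tangentSpace n M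
  have : IsManifold (𝓡 n) 1 M := .of_le (n := ∞) (by simp)
  obtain ⟨C, hC, h⟩ := eventually_norm_mfderivWithin_symm_extChartAt_lt (𝓡 n) p
  simp only [modelWithCornersSelf_coe, Set.range_id, nhdsWithin_univ, mfderivWithin_univ] at h
  refine ⟨C, h.mono fun y hy v w ↦ ?_⟩
  refine (abs_real_inner_le_norm _ _).trans ?_
  refine mul_le_mul ?_ ?_ (norm_nonneg _) (by positivity)
  · exact (ContinuousLinearMap.le_opNorm _ _).trans
      (mul_le_mul_of_nonneg_right hy.le (norm_nonneg _))
  · exact (ContinuousLinearMap.le_opNorm _ _).trans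
      (mul_le_mul_of_nonneg_right hy.le (norm_nonneg _))

/-- The entries are bounded near `p`, hence so is the determinant. -/
theorem eventually_det_gramMatrix_le (p : M) :
    ∃ K : ℝ, ∀ᶠ y in 𝓝 (extChartAt (𝓡 n) p p), (gramMatrix n p y).det ≤ K := by
  obtain ⟨C, h⟩ := eventually_metricAt_chartSymmDeriv_le (n := n) p
  refine ⟨_, h.mono fun y hy ↦ (le_abs_self _).trans
    (Matrix.det_le (abv := AbsoluteValue.abs) (x := C * C) fun i j ↦ ?_)⟩
  rw [gramMatrix_apply]
  simpa using hy (EuclideanSpace.single i 1) (EuclideanSpace.single j 1)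

/-- A path from `x` to `z` of length below `s` stays where the derivative of the chart is bounded by
`C`, so its image has length at most `C * s`. -/
theorem exists_edist_extChartAt_le [IsRiemannianManifold (𝓡 n) M] (p : M) :
    ∃ C : ℝ≥0, ∃ δ > (0 : ℝ≥0∞), ∀ x z : M, ∀ s ≤ δ, edist p x < δ → edist x z < s →
      edist (extChartAt (𝓡 n) p x) (extChartAt (𝓡 n) p z) ≤ C * s := by
  have : IsManifold (𝓡 n) 1 M := .of_le (n := ∞) (by simp)
  obtain ⟨C, hC⟩ := eventually_enorm_mfderiv_extChartAt_apply_le (n := n) p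
  obtain ⟨ε, hε, hU⟩ := EMetric.mem_nhds_iff.1 (hC.and (extChartAt_source_mem_nhds (I := 𝓡 n) p))
  refine ⟨C, ε / 2, ENNReal.half_pos hε.ne', fun x z s hs hx hz ↦ ?_⟩
  rw [IsRiemannianManifold.out (I := 𝓡 n)] at hz
  obtain ⟨γ, hγ0, hγ1, hγs, hγ⟩ := exists_lt_of_riemannianEDist_lt hz
  have hmem : ∀ t ∈ Set.Icc (0 : ℝ) 1, γ t ∈ Metric.eball p ε := by
    intro t ht
    have h1 : edist x (γ t) ≤ pathELength (𝓡 n) γ 0 t := by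
      rw [IsRiemannianManifold.out (I := 𝓡 n)]
      exact riemannianEDist_le_pathELength (hγs.mono (Set.Icc_subset_Icc_right ht.2)) hγ0 rfl ht.1
    have h2 : edist x (γ t) < ε / 2 :=
      ((h1.trans (pathELength_mono le_rfl ht.2)).trans_lt hγ).trans_le hs
    rw [Metric.mem_eball, edist_comm]
    calc edist p (γ t) ≤ edist p x + edist x (γ t) := edist_triangle _ _ _
      _ < ε / 2 + ε / 2 := ENNReal.add_lt_add hx h2
      _ = ε := ENNReal.add_halves ε
  set η := extChartAt (𝓡 n) p ∘ γ with hη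
  have hsrc : ∀ t ∈ Set.Icc (0 : ℝ) 1, γ t ∈ (chartAt (EuclideanSpace ℝ (Fin n)) p).source := by
    intro t ht
    rw [← extChartAt_source (𝓡 n)]
    exact (hU (hmem t ht)).2
  have hηs : ContMDiffOn 𝓘(ℝ) 𝓘(ℝ, EuclideanSpace ℝ (Fin n)) 1 η (Set.Icc 0 1) :=
    contMDiffOn_extChartAt.comp (I' := 𝓡 n)
      (t := (chartAt (EuclideanSpace ℝ (Fin n)) p).source) hγs hsrc
  have h0 : extChartAt (𝓡 n) p x = η 0 := by rw [hη, Function.comp_apply, hγ0]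
  have h1 : extChartAt (𝓡 n) p z = η 1 := by rw [hη, Function.comp_apply, hγ1]
  rw [h0, h1, edist_comm, edist_eq_enorm_sub]
  calc ‖η 1 - η 0‖ₑ ≤ ∫⁻ t in Set.Icc (0 : ℝ) 1, ‖derivWithin η (Set.Icc 0 1) t‖ₑ :=
        enorm_sub_le_lintegral_derivWithin_Icc_of_contDiffOn_Icc
          (contMDiffOn_iff_contDiffOn.1 hηs) zero_le_one
    _ ≤ ∫⁻ t in Set.Icc (0 : ℝ) 1, C * ‖mfderivWithin 𝓘(ℝ) (𝓡 n) γ (Set.Icc 0 1) t 1‖ₑ := by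
        refine setLIntegral_mono' measurableSet_Icc fun t ht ↦ ?_
        have hcomp := mfderiv_comp_mfderivWithin (I := 𝓘(ℝ)) (I' := 𝓡 n)
          (I'' := 𝓘(ℝ, EuclideanSpace ℝ (Fin n))) (s := Set.Icc 0 1) t
          (mdifferentiableAt_extChartAt (I := 𝓡 n) (hsrc t ht))
          (hγs.mdifferentiableOn one_ne_zero t ht)
          (uniqueMDiffWithinAt_iff_uniqueDiffWithinAt.2 (uniqueDiffOn_Icc zero_lt_one t ht))
        have hd : derivWithin η (Set.Icc 0 1) t =
            mfderiv (𝓡 n) 𝓘(ℝ, EuclideanSpace ℝ (Fin n)) (extChartAt (𝓡 n) p) (γ t)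
              (mfderivWithin 𝓘(ℝ) (𝓡 n) γ (Set.Icc 0 1) t 1) := by
          rw [← fderivWithin_derivWithin]
          rw [mfderivWithin_eq_fderivWithin] at hcomp
          exact DFunLike.congr_fun hcomp (1 : ℝ)
        exact (congrArg enorm hd).trans_le ((hU (hmem t ht)).1 _)
    _ = C * pathELength (𝓡 n) γ 0 1 := by
        rw [lintegral_const_mul' _ _ ENNReal.coe_ne_top,
          pathELength_eq_lintegral_mfderivWithin_Icc]
    _ ≤ C * s := by gcongr

end ChartBounds

/-! ### Uniform upper bound for the volume of small balls. -/

section BallVolume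

variable {n : ℕ} {M : Type*} [EMetricSpace M] [CompactSpace M]
  [ChartedSpace (EuclideanSpace ℝ (Fin n)) M] [IsManifold (𝓡 n) ∞ M]
  [RiemannianBundle (fun x : M ↦ TangentSpace (𝓡 n) x)]
  [IsContMDiffRiemannianBundle (𝓡 n) ∞ (EuclideanSpace ℝ (Fin n))
    (fun x : M ↦ TangentSpace (𝓡 n) x)]
  [IsRiemannianManifold (𝓡 n) M] [MeasurableSpace M] [BorelSpace M]

variable (n) in
/-- Near every point, the volume of a ball of radius `r` is `O(rⁿ)`. -/
theorem exists_riemannianVolume_closedEBall_le_local (p : M) :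
    ∃ K : ℝ, ∃ ε > (0 : ℝ≥0∞), ∀ x : M, edist p x < ε → ∀ r : ℝ, 0 < r → ENNReal.ofReal r < ε →
      riemannianVolume n M (Metric.closedEBall x (ENNReal.ofReal r)) ≤
        ENNReal.ofReal (K * r ^ n) := by
  have : SecondCountableTopology M := EMetric.secondCountable_of_sigmaCompact M
  obtain ⟨C, δ, hδ, hC⟩ := exists_edist_extChartAt_le (n := n) p
  obtain ⟨K, hK⟩ := eventually_det_gramMatrix_le (n := n) p
  have hK' := (continuousAt_extChartAt (I := 𝓡 n) p).eventually hK
  obtain ⟨ε, hε, hU⟩ :=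
    EMetric.mem_nhds_iff.1 (hK'.and (extChartAt_source_mem_nhds (I := 𝓡 n) p))
  refine ⟨√K * ((2 * C) ^ n * volume.real (Metric.ball (0 : EuclideanSpace ℝ (Fin n)) 1)),
    min δ ε / 2, ENNReal.half_pos (lt_min hδ hε).ne', fun x hx r hr hrε ↦ ?_⟩
  set B := Metric.closedEBall x (ENNReal.ofReal r) with hB
  have hhalf : min δ ε / 2 ≤ min δ ε := ENNReal.half_le_self
  have hBU : B ⊆ Metric.eball p ε := by
    intro z hz
    rw [hB, Metric.mem_closedEBall, edist_comm] at hz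
    rw [Metric.mem_eball, edist_comm]
    calc edist p z ≤ edist p x + edist x z := edist_triangle _ _ _
      _ < min δ ε / 2 + min δ ε / 2 := ENNReal.add_lt_add hx (hz.trans_lt hrε)
      _ = min δ ε := ENNReal.add_halves _
      _ ≤ ε := min_le_right _ _
  have hBm : MeasurableSet B := Metric.isClosed_closedEBall.measurableSet
  rw [riemannianVolume_apply_of_subset_source p hBm fun z hz ↦ (hU (hBU hz)).2,
    chartVolume_apply p hBm]
  -- The Lipschitz bound needs a strict inequality, so the closed ball of radius `r` is put in the
  -- open ball of radius `2 * r`.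
  have h2r : ENNReal.ofReal (2 * r) ≤ δ := by
    rw [two_mul, ENNReal.ofReal_add hr.le hr.le]
    calc _ ≤ min δ ε / 2 + min δ ε / 2 := add_le_add hrε.le hrε.le
      _ = min δ ε := ENNReal.add_halves _
      _ ≤ δ := min_le_left _ _
  set A := (extChartAt (𝓡 n) p).target ∩ (extChartAt (𝓡 n) p).symm ⁻¹' B with hA
  have hAsub : A ⊆ Metric.closedBall (extChartAt (𝓡 n) p x) (2 * C * r) := by
    rintro y ⟨hy, hyB⟩
    have hz : edist x ((extChartAt (𝓡 n) p).symm y) < ENNReal.ofReal (2 * r) := by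
      rw [edist_comm]
      exact (Metric.mem_closedEBall.1 hyB).trans_lt
        ((ENNReal.ofReal_lt_ofReal_iff (by positivity)).2 (by linarith))
    have h := hC x _ _ h2r (hx.trans_le (hhalf.trans (min_le_left _ _))) hz
    rw [(extChartAt (𝓡 n) p).right_inv hy, edist_comm, edist_dist,
      ← ENNReal.ofReal_coe_nnreal, ← ENNReal.ofReal_mul C.coe_nonneg,
      ENNReal.ofReal_le_ofReal_iff (by positivity)] at h
    rw [Metric.mem_closedBall]
    linarith
  calc ∫⁻ y in A, ENNReal.ofReal (√(gramMatrix n p y).det)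
      ≤ ∫⁻ _ in A, ENNReal.ofReal √K := by
        refine setLIntegral_mono' (measurableSet_target_inter_symm_preimage p hBm)
          fun y hy ↦ ENNReal.ofReal_le_ofReal (Real.sqrt_le_sqrt ?_)
        have h := (hU (hBU hy.2)).1
        change (gramMatrix n p (extChartAt (𝓡 n) p ((extChartAt (𝓡 n) p).symm y))).det ≤ K at h
        rwa [(extChartAt (𝓡 n) p).right_inv hy.1] at h
    _ = ENNReal.ofReal √K * volume A := by rw [setLIntegral_const]
    _ ≤ ENNReal.ofReal √K * volume (Metric.closedBall (extChartAt (𝓡 n) p x) (2 * C * r)) := by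
        gcongr
    _ = ENNReal.ofReal (√K * ((2 * C) ^ n *
          volume.real (Metric.ball (0 : EuclideanSpace ℝ (Fin n)) 1)) * r ^ n) := by
        rw [Measure.addHaar_closedBall _ _ (by positivity), finrank_euclideanSpace_fin,
          ← ENNReal.ofReal_toReal (measure_ball_lt_top (μ := volume)
            (x := (0 : EuclideanSpace ℝ (Fin n))) (r := 1)).ne,
          ← ENNReal.ofReal_mul (by positivity), ← ENNReal.ofReal_mul (by positivity),
          Measure.real]
        congr 1
        ring

variable (n M) in
/-- On a compact Riemannian manifold, the volume of a ball of radius `r` is `O(rⁿ)`, uniformly in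
the center. -/
theorem exists_riemannianVolume_closedEBall_le :
    ∃ K : ℝ, ∃ r₀ > 0, ∀ x : M, ∀ r : ℝ, 0 < r → r < r₀ →
      (riemannianVolume n M).real (Metric.closedEBall x (ENNReal.ofReal r)) ≤ K * r ^ n := by
  obtain ⟨K, hK, ε, hε, h⟩ : ∃ K : ℝ, 0 ≤ K ∧ ∃ ε > (0 : ℝ≥0∞), ∀ x ∈ (Set.univ : Set M), ∀ r : ℝ,
      0 < r → ENNReal.ofReal r < ε →
      riemannianVolume n M (Metric.closedEBall x (ENNReal.ofReal r)) ≤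
        ENNReal.ofReal (K * r ^ n) := by
    -- Compactness induction: the bound passes to subsets and to unions of two sets, and holds near
    -- each point.
    refine isCompact_univ.induction_on ⟨0, le_rfl, 1, one_pos, by simp⟩ ?_ ?_ ?_
    · rintro s t hst ⟨K, hK, ε, hε, h⟩
      exact ⟨K, hK, ε, hε, fun x hx ↦ h x (hst hx)⟩
    · rintro s t ⟨K, hK, ε, hε, h⟩ ⟨K', hK', ε', hε', h'⟩
      refine ⟨max K K', le_max_of_le_left hK, min ε ε', lt_min hε hε', ?_⟩
      rintro x (hx | hx) r hr hrε
      · refine (h x hx r hr (hrε.trans_le (min_le_left _ _))).trans (ENNReal.ofReal_le_ofReal ?_)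
        gcongr
        exact le_max_left _ _
      · refine (h' x hx r hr (hrε.trans_le (min_le_right _ _))).trans (ENNReal.ofReal_le_ofReal ?_)
        gcongr
        exact le_max_right _ _
    · intro p _
      obtain ⟨K, ε, hε, h⟩ := exists_riemannianVolume_closedEBall_le_local n p
      refine ⟨Metric.eball p ε, mem_nhdsWithin_of_mem_nhds (Metric.eball_mem_nhds p hε),
        max K 0, le_max_right _ _, ε, hε, fun x hx r hr hrε ↦ ?_⟩
      refine (h x (by rwa [edist_comm]) r hr hrε).trans (ENNReal.ofReal_le_ofReal ?_)
      gcongr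
      exact le_max_left _ _
  -- `ε` may be `⊤`; the minimum with `1` yields a real radius.
  have htop : min ε 1 ≠ ⊤ := ((min_le_right _ _).trans_lt ENNReal.one_lt_top).ne
  refine ⟨K, (min ε 1).toReal, ENNReal.toReal_pos (lt_min hε one_pos).ne' htop,
    fun x r hr hr₀ ↦ ?_⟩
  have hrε := (ENNReal.ofReal_lt_iff_lt_toReal hr.le htop).2 hr₀
  exact ENNReal.toReal_le_of_le_ofReal (by positivity)
    (h x trivial r hr (hrε.trans_le (min_le_left _ _)))

end BallVolume

theorem unitBallVolume_pos (n : ℕ) : 0 < unitBallVolume n :=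
  ENNReal.toReal_pos
    (Metric.measure_closedBall_pos volume (0 : EuclideanSpace ℝ (Fin n)) one_pos).ne'
    (measure_closedBall_lt_top (μ := volume)).ne

/-! ### The estimator as a sum of weights. -/

section Estimator

/-- The function `1 / ρ` on the closed ball of radius `r` around `x`, extended by zero. -/
noncomputable def ballWeight {M : Type*} [EMetricSpace M] (ρ : M → ℝ) (x : M) (r : ℝ) : M → ℝ :=
  (Metric.closedEBall x (ENNReal.ofReal r)).indicator fun z ↦ 1 / ρ z

theorem ballWeight_nonneg {M : Type*} [EMetricSpace M] {ρ : M → ℝ} (hρ : ∀ z, 0 < ρ z) (x : M)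
    (r : ℝ) (z : M) : 0 ≤ ballWeight ρ x r z :=
  Set.indicator_nonneg (fun z _ ↦ (one_div_pos.2 (hρ z)).le) z

theorem ballWeight_le {M : Type*} [EMetricSpace M] {ρ : M → ℝ} {b : ℝ} (hb : 0 < b)
    (h : ∀ z, 1 / ρ z ≤ b) (x : M) (r : ℝ) (z : M) : ballWeight ρ x r z ≤ b :=
  Set.indicator_apply_le' (fun _ ↦ h z) fun _ ↦ hb.le

/-- The count cancels against the harmonic mean. Without neighbours both sides vanish, whatever the
default density. -/
theorem ballVolumeEst_eq_sum {N : ℕ} (dX : Matrix (Fin N) (Fin N) ℝ≥0∞) (ρhat : Fin N → ℝ)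
    (i : Fin N) (r : ℝ) :
    ballVolumeEst dX ρhat i r = ((N : ℝ) - 1)⁻¹ * ∑ j ∈ neighbors dX i r, 1 / ρhat j := by
  rw [ballVolumeEst, meanDensityEst]
  split_ifs with h
  · have h' : (numNeighbors dX i r : ℝ) ≠ 0 := by positivity
    rw [div_eq_mul_inv, mul_inv, inv_inv]
    field_simp
  · have h0 : numNeighbors dX i r = 0 := by omega
    have hs : neighbors dX i r = ∅ := Finset.card_eq_zero.1 h0
    simp [h0, hs]

theorem sampleBallRatio_eq_sum (n : ℕ) {M : Type*} [EMetricSpace M] (ρ : M → ℝ) {N : ℕ}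
    {Ω : Type*} (X : Fin N → Ω → M) (i : Fin N) (x : M) (hx : ∀ w, X i w = x) (r : ℝ) :
    sampleBallRatio n ρ X i r = fun w ↦ (((N : ℝ) - 1) * (unitBallVolume n * r ^ n))⁻¹ *
      (∑ j ∈ Finset.univ.erase i, ballWeight ρ x r ∘ X j) w := by
  classical
  ext w
  have hsum : ∑ j ∈ neighbors (distMatrix fun j ↦ X j w) i r, 1 / ρ (X j w) =
      ∑ j ∈ Finset.univ.erase i, ballWeight ρ x r (X j w) := by
    have hn : neighbors (distMatrix fun j ↦ X j w) i r = (Finset.univ.erase i).filter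
        fun j ↦ X j w ∈ Metric.closedEBall x (ENNReal.ofReal r) := by
      ext j
      simp [neighbors, distMatrix, hx, edist_comm]
    rw [hn, Finset.sum_filter]
    exact Finset.sum_congr rfl fun j _ ↦ by simp [ballWeight, Set.indicator_apply]
  rw [sampleBallRatio, ballRatioEst, ballVolumeEst_eq_sum, hsum, Finset.sum_apply]
  simp only [Function.comp_apply, div_eq_mul_inv, mul_inv]
  ring

end Estimator

/-! ### Mean and variance of the estimator. -/

section Moments

variable {n : ℕ} {M : Type*} [EMetricSpace M] [ChartedSpace (EuclideanSpace ℝ (Fin n)) M]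
  [RiemannianBundle (fun x : M ↦ TangentSpace (𝓡 n) x)] [MeasurableSpace M]
  {ρ : M → ℝ}

theorem IsPdf.exists_one_div_le [CompactSpace M] (hρ : IsPdf n ρ) :
    ∃ b, 0 < b ∧ ∀ z, 1 / ρ z ≤ b := by
  have hc : Continuous fun z ↦ 1 / ρ z :=
    continuous_const.div hρ.continuous fun z ↦ (hρ.pos z).ne'
  obtain ⟨b, hb⟩ := (isCompact_range hc).bddAbove
  exact ⟨max b 1, by positivity, fun z ↦ (hb ⟨z, rfl⟩).trans (le_max_left _ _)⟩

variable [BorelSpace M] {Ω : Type*} [MeasurableSpace Ω] {P : Measure Ω}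

theorem measurable_ballWeight (hρ : Continuous ρ) (x : M) (r : ℝ) :
    Measurable (ballWeight ρ x r) :=
  (measurable_const.div hρ.measurable).indicator Metric.isClosed_closedEBall.measurableSet

/-- The density `ρ` of the law cancels the factor `1 / ρ`. -/
theorem IsPdf.integral_ballWeight (hρ : IsPdf n ρ) {Y : Ω → M}
    (hY : HasLaw Y (densityMeasure n ρ) P) (x : M) (r : ℝ) :
    P[ballWeight ρ x r ∘ Y] =
      (riemannianVolume n M).real (Metric.closedEBall x (ENNReal.ofReal r)) := by
  rw [hY.integral_comp (measurable_ballWeight hρ.continuous x r).aestronglyMeasurable,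
    densityMeasure, integral_withDensity_eq_integral_toReal_smul
      hρ.continuous.measurable.ennreal_ofReal (by simp),
    ← integral_indicator_one Metric.isClosed_closedEBall.measurableSet]
  refine integral_congr_ae (.of_forall fun z ↦ ?_)
  have h := hρ.pos z
  by_cases hz : z ∈ Metric.closedEBall x (ENNReal.ofReal r)
  · simp [ballWeight, hz, ENNReal.toReal_ofReal h.le, h.ne']
  · simp [ballWeight, hz]

theorem IsPdf.memLp_ballWeight [CompactSpace M] [IsProbabilityMeasure P] (hρ : IsPdf n ρ)
    {Y : Ω → M} (hY : AEMeasurable Y P) (x : M) (r : ℝ) : MemLp (ballWeight ρ x r ∘ Y) 2 P := by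
  obtain ⟨b, hb, h⟩ := hρ.exists_one_div_le
  refine MemLp.of_bound ((measurable_ballWeight hρ.continuous x r).comp_aemeasurable
    hY).aestronglyMeasurable b (.of_forall fun w ↦ ?_)
  rw [Function.comp_apply, Real.norm_of_nonneg (ballWeight_nonneg hρ.pos _ _ _)]
  exact ballWeight_le hb h _ _ _

/-- Since `0 ≤ w ≤ b` for the weight `w`, `w² ≤ b w`. Bounding by the mean rather than by `b²` keeps
the factor `vol B`, which later cancels one `rⁿ`. -/
theorem IsPdf.variance_ballWeight_le [CompactSpace M] [IsProbabilityMeasure P] (hρ : IsPdf n ρ)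
    {b : ℝ} (hb : 0 < b) (h : ∀ z, 1 / ρ z ≤ b)
    {Y : Ω → M} (hY : HasLaw Y (densityMeasure n ρ) P) (x : M) (r : ℝ) :
    Var[ballWeight ρ x r ∘ Y; P] ≤
      b * (riemannianVolume n M).real (Metric.closedEBall x (ENNReal.ofReal r)) := by
  have hL := hρ.memLp_ballWeight hY.aemeasurable x r
  refine (variance_le_expectation_sq hL.aestronglyMeasurable).trans ?_
  rw [← hρ.integral_ballWeight hY, ← integral_const_mul]
  refine integral_mono hL.integrable_sq ((hL.integrable one_le_two).const_mul b) fun w ↦ ?_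
  simp only [Pi.pow_apply, Function.comp_apply, pow_two]
  exact mul_le_mul_of_nonneg_right (ballWeight_le hb h _ _ _) (ballWeight_nonneg hρ.pos _ _ _)

variable {N : ℕ} {i : Fin N} {x : M} {X : Fin N → Ω → M}

theorem IsSampleAt.memLp_sampleBallRatio [CompactSpace M] [IsProbabilityMeasure P]
    (hρ : IsPdf n ρ) (hX : IsSampleAt n ρ i x P X) (r : ℝ) :
    MemLp (sampleBallRatio n ρ X i r) 2 P := by
  rw [sampleBallRatio_eq_sum n ρ X i x hX.center r]
  exact (memLp_finsetSum' _ fun j hj ↦ hρ.memLp_ballWeight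
    (hX.law j (Finset.ne_of_mem_erase hj)).aemeasurable x r).const_mul _

theorem IsSampleAt.integral_sampleBallRatio [CompactSpace M] [IsProbabilityMeasure P]
    (hρ : IsPdf n ρ) (hX : IsSampleAt n ρ i x P X) (hN : 2 ≤ N) (r : ℝ) :
    P[sampleBallRatio n ρ X i r] = ballRatio n x r := by
  have hN' : (N : ℝ) - 1 ≠ 0 := by
    have : (2 : ℝ) ≤ N := by exact_mod_cast hN
    linarith
  rw [sampleBallRatio_eq_sum n ρ X i x hX.center r, integral_const_mul]
  simp only [Finset.sum_apply]
  rw [integral_finsetSum _ fun j hj ↦ (hρ.memLp_ballWeight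
    (hX.law j (Finset.ne_of_mem_erase hj)).aemeasurable x r).integrable one_le_two,
    Finset.sum_congr rfl fun j hj ↦
      hρ.integral_ballWeight (hX.law j (Finset.ne_of_mem_erase hj)) x r,
    Finset.sum_const, Finset.card_erase_of_mem (Finset.mem_univ i), Finset.card_univ,
    Fintype.card_fin, nsmul_eq_mul, Nat.cast_sub (by omega), Nat.cast_one, ballRatio, mul_inv,
    div_eq_mul_inv]
  field_simp

/-- Independence makes the variance a sum of `N - 1` terms, and the squared prefactor leaves `1 / (N
- 1)`. -/
theorem IsSampleAt.variance_sampleBallRatio_le [CompactSpace M] [IsProbabilityMeasure P]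
    (hρ : IsPdf n ρ) (hX : IsSampleAt n ρ i x P X) (hN : 2 ≤ N) {b : ℝ} (hb : 0 < b)
    (h : ∀ z, 1 / ρ z ≤ b) (r : ℝ) :
    Var[sampleBallRatio n ρ X i r; P] ≤
      b * (riemannianVolume n M).real (Metric.closedEBall x (ENNReal.ofReal r)) /
        (((N : ℝ) - 1) * (unitBallVolume n * r ^ n) ^ 2) := by
  have hN' : (N : ℝ) - 1 ≠ 0 := by
    have : (2 : ℝ) ≤ N := by exact_mod_cast hN
    linarith
  have hind := hX.indep.comp (fun _ ↦ ballWeight ρ x r)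
    fun _ ↦ measurable_ballWeight hρ.continuous x r
  rw [sampleBallRatio_eq_sum n ρ X i x hX.center r, variance_const_mul, IndepFun.variance_sum
    (fun j hj ↦ hρ.memLp_ballWeight (hX.law j (Finset.ne_of_mem_erase hj)).aemeasurable x r)
    fun j _ k _ hjk ↦ hind.indepFun hjk]
  calc _ ≤ (((N : ℝ) - 1) * (unitBallVolume n * r ^ n))⁻¹ ^ 2 * ∑ _j ∈ Finset.univ.erase i,
          b * (riemannianVolume n M).real (Metric.closedEBall x (ENNReal.ofReal r)) := by
        gcongr with j hj
        exact hρ.variance_ballWeight_le hb h (hX.law j (Finset.ne_of_mem_erase hj)) x r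
    _ = _ := by
        rw [Finset.sum_const, Finset.card_erase_of_mem (Finset.mem_univ i), Finset.card_univ,
          Fintype.card_fin, nsmul_eq_mul, Nat.cast_sub (by omega), Nat.cast_one]
        field_simp

end Moments

theorem proposition5p1 (n : ℕ) (M : Type*) [EMetricSpace M] [CompactSpace M]
    [ChartedSpace (EuclideanSpace ℝ (Fin n)) M] [IsManifold (𝓡 n) ∞ M]
    [RiemannianBundle (fun x : M ↦ TangentSpace (𝓡 n) x)]
    [IsContMDiffRiemannianBundle (𝓡 n) ∞ (EuclideanSpace ℝ (Fin n))
      (fun x : M ↦ TangentSpace (𝓡 n) x)]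
    [IsRiemannianManifold (𝓡 n) M] [MeasurableSpace M] [BorelSpace M]
    (ρ : M → ℝ) (hρ : IsPdf n ρ) :
    (∀ N : ℕ, 2 ≤ N → ∀ r : ℝ, 0 < r → ∀ (i : Fin N) (x : M)
      (Ω : Type*) [MeasurableSpace Ω] (P : Measure Ω) [IsProbabilityMeasure P]
      (X : Fin N → Ω → M), IsSampleAt n ρ i x P X →
        MemLp (sampleBallRatio n ρ X i r) 2 P ∧
        P[sampleBallRatio n ρ X i r] = ballRatio n x r ∧
        meanSquaredError P (sampleBallRatio n ρ X i r) (ballRatio n x r) =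
          Var[sampleBallRatio n ρ X i r; P]) ∧
    ∃ A : ℝ, 0 < A ∧ ∃ N₀ : ℕ, ∃ r₀ : ℝ, 0 < r₀ ∧
      ∀ N : ℕ, N₀ ≤ N → ∀ r : ℝ, 0 < r → r < r₀ → ∀ (i : Fin N) (x : M)
        (Ω : Type*) [MeasurableSpace Ω] (P : Measure Ω) [IsProbabilityMeasure P]
        (X : Fin N → Ω → M), IsSampleAt n ρ i x P X →
          Var[sampleBallRatio n ρ X i r; P] ≤ A / (N * r ^ n) := by
  constructor
  · intro N hN r _ i x Ω _ P _ X hX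
    have hL := hX.memLp_sampleBallRatio hρ r
    have hE := hX.integral_sampleBallRatio hρ hN r
    refine ⟨hL, hE, ?_⟩
    rw [meanSquaredError, variance_eq_integral hL.aemeasurable, hE]
  · obtain ⟨b, hb, hρb⟩ := hρ.exists_one_div_le
    obtain ⟨K, r₀, hr₀, hK⟩ := exists_riemannianVolume_closedEBall_le n M
    have hv := unitBallVolume_pos n
    -- The `2` comes from `N - 1 ≥ N / 2` for `N ≥ 2`; `max K 1` ensures that `A` is positive.
    refine ⟨2 * b * max K 1 / unitBallVolume n ^ 2, by positivity, 2, r₀, hr₀, ?_⟩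
    intro N hN r hr hrr₀ i x Ω _ P _ X hX
    have hN' : (2 : ℝ) ≤ N := by exact_mod_cast hN
    refine (hX.variance_sampleBallRatio_le hρ hN hb hρb r).trans ?_
    calc _ ≤ b * (max K 1 * r ^ n) / ((N / 2 : ℝ) * (unitBallVolume n * r ^ n) ^ 2) := by
          gcongr
          · exact (hK x r hr hrr₀).trans (by gcongr; exact le_max_left _ _)
          · linarith
      _ = _ := by field_simp
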